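/- Let $n \ge 3$ and $m \ge 1$ be integers, let $A = (A_{ij})$ be a constant real symmetric positive definite $m \times m$ matrix, let $q > \frac{n+2}{n}$ and put $p = \frac n2 (q-1)$. Let $f^1, \dots, f^m : \mathbb{R}^m \to \mathbb{R}$ be differentiable functions for which there is a constant $C$ such that $$|f^i(v)| \le C|v|^q, \qquad |\nabla f^i(v)| \le C|v|^{q-1} \qquad \text{for all } v \in \mathbb{R}^m,\ 1 \le i \le m.$$ Let $K \subset \mathbb{R}^n$ be compact, and let $V = (V_1, \dots, V_m) \in L^p(\mathbb{R}^n \setminus K; \mathbb{R}^m)$ be a classical ($C^2$) solution, with components of arbitrary sign, of the system $$\sum_{j=1}^m A_{ij}\, \Delta V_j = f^i(V) \quad \text{in } \mathbb{R}^n \setminus K, \qquad i = 1, \dots, m.$$ Then $$|V(x)| = O\big(|x|^{-(n-2)}\big) \quad\text{and}\quad |\nabla V(x)| = O\big(|x|^{-(n-1)}\big) \quad \text{as } |x| \to \infty,$$ where $|\nabla V|^2 = \sum_{j} |\nabla V_j|^2$. -/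

import Mathlib

open Set Filter Asymptotics MeasureTheory

/-- `V` is a (classical) solution on the open set `U` of the reaction-diffusion system
`∑ j, A i j * Δ V_j = f i (V)`, for all `i`: it is twice continuously differentiable on `U` and
satisfies the equations at every point of `U`. -/
def IsSolutionOn {n m : ℕ} (A : Matrix (Fin m) (Fin m) ℝ)
    (f : Fin m → EuclideanSpace ℝ (Fin m) → ℝ)
    (V : EuclideanSpace ℝ (Fin n) → EuclideanSpace ℝ (Fin m))
    (U : Set (EuclideanSpace ℝ (Fin n))) : Prop :=
  ContDiffOn ℝ 2 V U ∧
    ∀ x ∈ U, ∀ i, ∑ j, A i j * Laplacian.laplacian (fun y => V y j) x = f i (V x)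

/-- The Euclidean norm `|∇V| = (∑ j, |∇V_j|²)^(1/2)` of the gradient of a vector-valued map. -/
noncomputable def gradNorm {n m : ℕ}
    (V : EuclideanSpace ℝ (Fin n) → EuclideanSpace ℝ (Fin m))
    (x : EuclideanSpace ℝ (Fin n)) : ℝ :=
  Real.sqrt (∑ j, ‖gradient (fun y => V y j) x‖ ^ 2)

/-! Write `q = 1 + 2s`, so that `p = ns`. Since `A` is invertible, every scalar component `u = ⟪e,
V⟫` with `‖e‖ = 1` satisfies `|Δu| ≤ C₁ |V|^(1+2s)`; nothing else about the system matters. This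
inequality is invariant under `V ↦ t^(1/s) V(t x)`, and so is `∫ |V|^p`.

Near infinity the energy is small, and small energy forces `|x| |V(x)|^s → 0`
(`exists_energy_threshold`): a large value of `V`, chosen by maximising a weighted norm, would
persist on a ball of comparable scale by the gradient estimate `norm_fderiv_le_of_laplacian_bound`,
and this costs a fixed amount of energy.

Hence `|Δu| ≤ o(|x|⁻²) |V|`, a perturbation of harmonicity. Comparison of `|V|` with radial
supersolutions (`norm_le_of_supersolution`) gives the decay `|x|^(-α)` for `α < n - 2`; for `α`
close to `n - 2` the right-hand side then decays faster than `|x|^(-n)`, and a second comparison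
reaches the exponent `n - 2`. The gradient estimate on balls of radius `|x| / 2` gives the decay of
`∇V`. -/

theorem hasDerivAt_quadratic (a b c t : ℝ) :
    HasDerivAt (fun t : ℝ => a + b * t + c * t ^ 2) (b + 2 * c * t) t := by
  have := (((hasDerivAt_id t).const_mul b).const_add a).add ((hasDerivAt_pow 2 t).const_mul c)
  refine this.congr_deriv ?_
  norm_num
  ring

/-! ### Second derivatives along lines, the maximum principle, explicit Laplacians -/

section Laplacian

variable {E : Type*} [NormedAddCommGroup E] [InnerProductSpace ℝ E]

theorem hasDerivAt_comp_line {f : E → ℝ} {x v : E} {t : ℝ}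
    (hf : DifferentiableAt ℝ f (x + t • v)) :
    HasDerivAt (fun t : ℝ => f (x + t • v)) (fderiv ℝ f (x + t • v) v) t := by
  have h1 : HasDerivAt (fun t : ℝ => x + t • v) v t := by
    simpa using ((hasDerivAt_id t).smul_const v).const_add x
  exact hf.hasFDerivAt.comp_hasDerivAt t h1

theorem tendsto_line (x v : E) : Tendsto (fun t : ℝ => x + t • v) (nhds 0) (nhds x) := by
  have : Continuous (fun t : ℝ => x + t • v) := by fun_prop
  simpa using this.tendsto 0

theorem ContDiffAt.eventually_hasDerivAt_line {f : E → ℝ} {x : E} (hf : ContDiffAt ℝ 2 f x)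
    (v : E) : ∀ᶠ t : ℝ in nhds 0,
      HasDerivAt (fun t : ℝ => f (x + t • v)) (fderiv ℝ f (x + t • v) v) t := by
  have h1 : ∀ᶠ y in nhds x, ContDiffAt ℝ 2 f y := hf.eventually (by simp)
  filter_upwards [(tendsto_line x v).eventually h1] with t ht
  exact hasDerivAt_comp_line (ht.differentiableAt (by norm_num))

theorem ContDiffAt.hasDerivAt_fderiv_line {f : E → ℝ} {x : E} (hf : ContDiffAt ℝ 2 f x) (v : E) :
    HasDerivAt (fun t : ℝ => fderiv ℝ f (x + t • v) v) (iteratedFDeriv ℝ 2 f x ![v, v]) 0 := by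
  have h2 : DifferentiableAt ℝ (fderiv ℝ f) x :=
    (hf.fderiv_right (m := 1) (by norm_num)).differentiableAt (by norm_num)
  have h1 : HasDerivAt (fun t : ℝ => x + t • v) v 0 := by
    simpa using ((hasDerivAt_id (0 : ℝ)).smul_const v).const_add x
  have h3 : HasFDerivAt (fderiv ℝ f) (fderiv ℝ (fderiv ℝ f) x) (x + (0 : ℝ) • v) := by
    simpa using h2.hasFDerivAt
  have h4 := h3.comp_hasDerivAt (0 : ℝ) h1
  have h5 := h4.clm_apply (hasDerivAt_const (0 : ℝ) v)
  simpa [iteratedFDeriv_two_apply] using h5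

/-- The second derivative of `f` in a direction is computed along a line. -/
theorem ContDiffAt.iteratedFDeriv_two_eq_of_line {f : E → ℝ} {x v : E} (hf : ContDiffAt ℝ 2 f x)
    {g : ℝ → ℝ} {c : ℝ}
    (h1 : ∀ᶠ t : ℝ in nhds 0, HasDerivAt (fun t : ℝ => f (x + t • v)) (g t) t)
    (h2 : HasDerivAt g c 0) : iteratedFDeriv ℝ 2 f x ![v, v] = c := by
  have h3 : (fun t : ℝ => fderiv ℝ f (x + t • v) v) =ᶠ[nhds 0] g := by
    filter_upwards [h1, hf.eventually_hasDerivAt_line v] with t ha hb using hb.unique ha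
  exact ((hf.hasDerivAt_fderiv_line v).congr_of_eventuallyEq h3.symm).unique h2

/-- Were the second derivative positive, the point would also be a local minimum along the line; the
restriction would be locally constant and its second derivative zero. -/
theorem iteratedFDeriv_two_nonpos_of_isLocalMax {f : E → ℝ} {x : E} (hf : ContDiffAt ℝ 2 f x)
    (hx : IsLocalMax f x) (v : E) : iteratedFDeriv ℝ 2 f x ![v, v] ≤ 0 := by
  by_contra! hpos
  set g : ℝ → ℝ := fun t => f (x + t • v) with hg
  have hmax : IsLocalMax g 0 := by
    have := (tendsto_line x v).eventually hx
    simpa [IsLocalMax, IsMaxFilter, hg] using this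
  have hd : deriv g =ᶠ[nhds 0] fun t : ℝ => fderiv ℝ f (x + t • v) v :=
    (hf.eventually_hasDerivAt_line v).mono fun t ht => ht.deriv
  have hdd : deriv (deriv g) 0 = iteratedFDeriv ℝ 2 f x ![v, v] := by
    rw [hd.deriv_eq, (hf.hasDerivAt_fderiv_line v).deriv]
  have hmin : IsLocalMin g 0 := isLocalMin_of_deriv_deriv_pos (by rw [hdd]; exact hpos)
    hmax.deriv_eq_zero (hf.eventually_hasDerivAt_line v).self_of_nhds.continuousAt
  have hconst : g =ᶠ[nhds 0] fun _ => g 0 := by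
    filter_upwards [hmax, hmin] with t h1 h2 using le_antisymm h1 h2
  have h0 : deriv g =ᶠ[nhds 0] fun _ => (0 : ℝ) := by
    filter_upwards [hconst.eventuallyEq_nhds] with t ht
    rw [ht.deriv_eq, deriv_const]
  rw [h0.deriv_eq, deriv_const] at hdd
  linarith

variable [FiniteDimensional ℝ E]

theorem laplacian_nonpos_of_isLocalMax {f : E → ℝ} {x : E} (hf : ContDiffAt ℝ 2 f x)
    (hx : IsLocalMax f x) : Laplacian.laplacian f x ≤ 0 := by
  rw [InnerProductSpace.laplacian_eq_iteratedFDeriv_stdOrthonormalBasis]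
  exact Finset.sum_nonpos fun i _ => iteratedFDeriv_two_nonpos_of_isLocalMax hf hx _

theorem laplacian_le_of_isLocalMax_sub {f g : E → ℝ} {x : E} (hf : ContDiffAt ℝ 2 f x)
    (hg : ContDiffAt ℝ 2 g x) (hx : IsLocalMax (f - g) x) :
    Laplacian.laplacian f x ≤ Laplacian.laplacian g x := by
  have : Laplacian.laplacian (f - g) x ≤ 0 := laplacian_nonpos_of_isLocalMax (hf.sub hg) hx
  rw [hf.laplacian_sub hg] at this
  linarith

/-- Serves the barrier of `odd_part_le_barrier`, a quadratic polynomial with constant Laplacian. -/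
theorem laplacian_norm_sq_mul_add_inner (a b d : ℝ) {e : E} (he : ‖e‖ = 1) (x : E) :
    Laplacian.laplacian
      (fun y : E => a * ‖y‖ ^ 2 + b * (inner ℝ e y * (d - inner ℝ e y))) x =
      2 * a * Module.finrank ℝ E - 2 * b := by
  set f : E → ℝ := fun y : E => a * ‖y‖ ^ 2 + b * (inner ℝ e y * (d - inner ℝ e y)) with hf
  have hc : ContDiffAt ℝ 2 f x := by
    have h0 : ContDiff ℝ 2 (fun y : E => ‖y‖ ^ 2) := contDiff_norm_sq ℝ
    have h1 : ContDiff ℝ 2 (fun y : E => inner ℝ e y) := contDiff_const.inner ℝ contDiff_id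
    exact ((contDiff_const.mul h0).add
      (contDiff_const.mul (h1.mul (contDiff_const.sub h1)))).contDiffAt
  have key : ∀ v : E, iteratedFDeriv ℝ 2 f x ![v, v] =
      2 * a * ‖v‖ ^ 2 - 2 * b * (inner ℝ e v) ^ 2 := by
    intro v
    have hline : ∀ t : ℝ, f (x + t • v) = a * (‖x‖ ^ 2 + 2 * t * inner ℝ x v + t ^ 2 * ‖v‖ ^ 2)
        + b * ((inner ℝ e x + t * inner ℝ e v) * (d - (inner ℝ e x + t * inner ℝ e v))) := by
      intro t
      simp only [hf, inner_add_right, inner_smul_right, norm_add_sq_real, norm_smul,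
        Real.norm_eq_abs, mul_pow, sq_abs]
      ring
    refine hc.iteratedFDeriv_two_eq_of_line (g := fun t => a * (2 * inner ℝ x v + 2 * t * ‖v‖ ^ 2)
      + b * (inner ℝ e v * (d - 2 * inner ℝ e x) - 2 * t * inner ℝ e v ^ 2)) ?_ ?_
    · refine Eventually.of_forall fun t => ?_
      have : (fun t : ℝ => f (x + t • v)) = fun t => a * (‖x‖ ^ 2) + b * (inner ℝ e x *
          (d - inner ℝ e x)) + (a * (2 * inner ℝ x v) +
          b * (inner ℝ e v * (d - 2 * inner ℝ e x))) * t +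
          (a * ‖v‖ ^ 2 - b * inner ℝ e v ^ 2) * t ^ 2 := by
        funext t; rw [hline]; ring
      rw [this]
      exact (hasDerivAt_quadratic _ _ _ t).congr_deriv (by ring)
    · have : (fun t : ℝ => a * (2 * inner ℝ x v + 2 * t * ‖v‖ ^ 2)
          + b * (inner ℝ e v * (d - 2 * inner ℝ e x) - 2 * t * inner ℝ e v ^ 2)) = fun t =>
          (a * (2 * inner ℝ x v) + b * (inner ℝ e v * (d - 2 * inner ℝ e x))) +
          (2 * a * ‖v‖ ^ 2 - 2 * b * inner ℝ e v ^ 2) * t := by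
        funext t; ring
      rw [this]
      simpa using (((hasDerivAt_id (0:ℝ)).const_mul
        (2 * a * ‖v‖ ^ 2 - 2 * b * inner ℝ e v ^ 2)).const_add
        (a * (2 * inner ℝ x v) + b * (inner ℝ e v * (d - 2 * inner ℝ e x))))
  rw [InnerProductSpace.laplacian_eq_iteratedFDeriv_stdOrthonormalBasis]
  simp only [key]
  have hp : ∑ i, (inner ℝ e (stdOrthonormalBasis ℝ E i)) ^ 2 = ‖e‖ ^ 2 := by
    rw [← (stdOrthonormalBasis ℝ E).sum_sq_norm_inner_left e]
    simp
  rw [Finset.sum_sub_distrib, ← Finset.mul_sum, ← Finset.mul_sum, hp, he]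
  simp

omit [FiniteDimensional ℝ E] in
theorem contDiffAt_norm_rpow (s : ℝ) {x : E} (hx : x ≠ 0) :
    ContDiffAt ℝ 2 (fun y : E => ‖y‖ ^ s) x :=
  (contDiffAt_norm ℝ hx).rpow_const_of_ne (norm_ne_zero_iff.2 hx)

theorem laplacian_norm_rpow (s : ℝ) {x : E} (hx : x ≠ 0) :
    Laplacian.laplacian (fun y : E => ‖y‖ ^ s) x =
      s * (s + Module.finrank ℝ E - 2) * ‖x‖ ^ (s - 2) := by
  have hx0 : 0 < ‖x‖ := norm_pos_iff.2 hx
  have hc := contDiffAt_norm_rpow s hx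
  have key : ∀ v : E, iteratedFDeriv ℝ 2 (fun y : E => ‖y‖ ^ s) x ![v, v] =
      s * ‖x‖ ^ (s - 2) * ‖v‖ ^ 2 + s * (s - 2) * ‖x‖ ^ (s - 4) * (inner ℝ x v) ^ 2 := by
    intro v
    have hq : ∀ t : ℝ, HasDerivAt (fun t : ℝ => ‖x + t • v‖ ^ 2)
        (2 * inner ℝ x v + 2 * ‖v‖ ^ 2 * t) t := by
      intro t
      have : (fun t : ℝ => ‖x + t • v‖ ^ 2) = fun t => ‖x‖ ^ 2 + (2 * inner ℝ x v) * t +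
          ‖v‖ ^ 2 * t ^ 2 := by
        funext t
        simp only [inner_smul_right, norm_add_sq_real, norm_smul,
          Real.norm_eq_abs, mul_pow, sq_abs]
        ring
      rw [this]
      exact (hasDerivAt_quadratic _ _ _ t).congr_deriv (by ring)
    -- Powers of the norm are powers of `‖x + t • v‖ ^ 2`, a quadratic polynomial in `t`.
    have hrp : ∀ (y : E) (r : ℝ), ‖y‖ ^ r = (‖y‖ ^ 2) ^ (r / 2) := by
      intro y r
      rw [← Real.rpow_natCast, ← Real.rpow_mul (norm_nonneg y)]
      congr 1
      push_cast
      ring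
    have hne : ∀ᶠ t : ℝ in nhds 0, x + t • v ≠ 0 :=
      (tendsto_line x v).eventually (isOpen_ne.mem_nhds hx)
    have hpow : ∀ (r t : ℝ), x + t • v ≠ 0 → HasDerivAt (fun t : ℝ => ‖x + t • v‖ ^ r)
        ((2 * inner ℝ x v + 2 * ‖v‖ ^ 2 * t) * (r / 2) * ‖x + t • v‖ ^ (r - 2)) t := by
      intro r t ht
      have := (hq t).rpow_const (p := r / 2) (Or.inl (pow_ne_zero 2 (norm_ne_zero_iff.2 ht)))
      simp only [← hrp] at this
      convert this using 2
      rw [hrp]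
      congr 1
      ring
    refine hc.iteratedFDeriv_two_eq_of_line (hne.mono fun t ht => hpow s t ht) ?_
    have h1 : HasDerivAt (fun t : ℝ => (2 * inner ℝ x v + 2 * ‖v‖ ^ 2 * t) * (s / 2))
        (2 * ‖v‖ ^ 2 * (s / 2)) 0 := by
      simpa using (((hasDerivAt_id (0:ℝ)).const_mul (2 * ‖v‖ ^ 2)).const_add
        (2 * inner ℝ x v)).mul_const (s / 2)
    have h2 := h1.mul (hpow (s - 2) 0 (by simpa using hx))
    refine h2.congr_deriv ?_
    simp only [zero_smul, add_zero, mul_zero]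
    rw [show s - 2 - 2 = s - 4 by ring]
    ring
  rw [InnerProductSpace.laplacian_eq_iteratedFDeriv_stdOrthonormalBasis]
  simp only [key]
  have hp : ∑ i, (inner ℝ x (stdOrthonormalBasis ℝ E i)) ^ 2 = ‖x‖ ^ 2 := by
    rw [← (stdOrthonormalBasis ℝ E).sum_sq_norm_inner_left x]
    simp
  rw [Finset.sum_add_distrib, ← Finset.mul_sum, ← Finset.mul_sum, hp]
  have h4 : ‖x‖ ^ (s - 2) = ‖x‖ ^ (s - 4) * ‖x‖ ^ 2 := by
    rw [← Real.rpow_natCast, ← Real.rpow_add hx0]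
    congr 1
    push_cast
    ring
  simp
  rw [h4]
  ring

/-- The Laplacian may be computed in any orthonormal basis: use one basis at `x` and its image under
`σ` at `σ x`. -/
theorem laplacian_comp_linearIsometryEquiv {f : E → ℝ} (σ : E ≃ₗᵢ[ℝ] E) (x : E) :
    Laplacian.laplacian (fun y => f (σ y)) x = Laplacian.laplacian f (σ x) := by
  have h1 := congrFun (InnerProductSpace.laplacian_eq_iteratedFDeriv_orthonormalBasis
    (fun y => f (σ y)) (stdOrthonormalBasis ℝ E)) x
  have h2 := congrFun (InnerProductSpace.laplacian_eq_iteratedFDeriv_orthonormalBasis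
    f ((stdOrthonormalBasis ℝ E).map σ)) (σ x)
  rw [h1, h2]
  refine Finset.sum_congr rfl fun i _ => ?_
  have h3 := σ.toContinuousLinearEquiv.iteratedFDerivWithin_comp_right f uniqueDiffOn_univ
    (mem_univ (σ x)) 2
  simp only [preimage_univ, iteratedFDerivWithin_univ] at h3
  have h4 : (f ∘ σ.toContinuousLinearEquiv) = fun y => f (σ y) := rfl
  rw [h4] at h3
  rw [h3]
  simp only [ContinuousMultilinearMap.compContinuousLinearMap_apply]
  congr 1
  funext j
  fin_cases j <;> simp

theorem laplacian_comp_add_left {f : E → ℝ} (c x : E) :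
    Laplacian.laplacian (fun y => f (c + y)) x = Laplacian.laplacian f (c + x) := by
  simp only [InnerProductSpace.laplacian_eq_iteratedFDeriv_stdOrthonormalBasis,
    iteratedFDeriv_comp_add_left]

end Laplacian

theorem HasDerivAt.nonneg_of_nonneg_right {g : ℝ → ℝ} {g' d : ℝ} (hg : HasDerivAt g g' 0)
    (h0 : g 0 = 0) (hd : 0 < d) (hpos : ∀ t, 0 < t → t < d → 0 ≤ g t) : 0 ≤ g' := by
  refine ge_of_tendsto hg.tendsto_slope_zero_right ?_
  filter_upwards [Ioo_mem_nhdsGT hd] with t ht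
  have := hpos t ht.1 ht.2
  simp only [zero_add, h0, sub_zero, smul_eq_mul]
  exact mul_nonneg (inv_nonneg.2 ht.1.le) this

/-! ### Interior gradient estimate by reflection and a barrier -/

section GradientEstimate

variable {E : Type*} [NormedAddCommGroup E] [InnerProductSpace ℝ E] [FiniteDimensional ℝ E]

/-- The difference of `u` and its reflection vanishes on the hyperplane `e^⊥`, is at most `2M` on
the sphere, and has Laplacian at least `-2N`. The barrier dominates it on both boundary pieces of
the half ball and has Laplacian `-2N'`. As `N < N'`, the difference with the barrier has no interior
maximum. -/
theorem odd_part_le_barrier {u : E → ℝ} {d M N N' : ℝ} (hd : 0 < d)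
    (hu : ∀ y ∈ Metric.closedBall (0 : E) d, ContDiffAt ℝ 2 u y)
    (hM : ∀ y ∈ Metric.closedBall (0 : E) d, |u y| ≤ M)
    (hN : ∀ y ∈ Metric.closedBall (0 : E) d, |Laplacian.laplacian u y| ≤ N) (hN' : N < N')
    {e : E} (he : ‖e‖ = 1) {y : E} (hy : y ∈ Metric.closedBall (0 : E) d)
    (hye : 0 ≤ inner ℝ e y) :
    u y - u ((ℝ ∙ e)ᗮ.reflection y) ≤ 2 * M / d ^ 2 * ‖y‖ ^ 2 +
      (2 * M / d ^ 2 * Module.finrank ℝ E + N') * (inner ℝ e y * (d - inner ℝ e y)) := by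
  set σ := (ℝ ∙ e)ᗮ.reflection with hσ
  set n : ℝ := (Module.finrank ℝ E : ℝ) with hn
  set ψ : E → ℝ := fun y => 2 * M / d ^ 2 * ‖y‖ ^ 2 +
      (2 * M / d ^ 2 * n + N') * (inner ℝ e y * (d - inner ℝ e y)) with hψ
  set φ : E → ℝ := fun y => u y - u (σ y) with hφ
  have h0mem : (0 : E) ∈ Metric.closedBall (0 : E) d := by simpa using hd.le
  have hM0 : 0 ≤ M := (abs_nonneg _).trans (hM 0 h0mem)
  have hN0 : 0 ≤ N := (abs_nonneg _).trans (hN 0 h0mem)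
  have hn0 : 0 ≤ n := by positivity
  have hσmem : ∀ y ∈ Metric.closedBall (0 : E) d, σ y ∈ Metric.closedBall (0 : E) d := by
    intro y hy
    simpa using hy
  have hcσ : ∀ y ∈ Metric.closedBall (0 : E) d, ContDiffAt ℝ 2 (fun y => u (σ y)) y := by
    intro y hy
    exact (hu _ (hσmem y hy)).comp y σ.toContinuousLinearEquiv.contDiff.contDiffAt
  have hcφ : ∀ y ∈ Metric.closedBall (0 : E) d, ContDiffAt ℝ 2 φ y :=
    fun y hy => (hu y hy).sub (hcσ y hy)
  have hcψ : ContDiff ℝ 2 ψ := by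
    have h0 : ContDiff ℝ 2 (fun y : E => ‖y‖ ^ 2) := contDiff_norm_sq ℝ
    have h1 : ContDiff ℝ 2 (fun y : E => inner ℝ e y) := contDiff_const.inner ℝ contDiff_id
    exact (contDiff_const.mul h0).add (contDiff_const.mul (h1.mul (contDiff_const.sub h1)))
  set H : Set E := Metric.closedBall (0 : E) d ∩ {y | 0 ≤ inner ℝ e y} with hH
  have hcomp : IsCompact H := by
    refine (isCompact_closedBall 0 d).inter_right (isClosed_le continuous_const ?_)
    fun_prop
  have hcont : ContinuousOn (φ - ψ) H := fun y hy =>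
    ((hcφ y hy.1).continuousAt.sub hcψ.continuous.continuousAt).continuousWithinAt
  obtain ⟨x, hxH, hx⟩ := hcomp.exists_isMaxOn ⟨y, hy, hye⟩ hcont
  have hxd : ‖x‖ ≤ d := by simpa using hxH.1
  have hxt : inner ℝ e x ≤ d := by
    calc inner ℝ e x ≤ ‖e‖ * ‖x‖ := real_inner_le_norm e x
      _ ≤ d := by rw [he, one_mul]; exact hxd
  have hx0 : 0 ≤ inner ℝ e x := hxH.2
  suffices h : φ x ≤ ψ x by
    have h1 : φ y - ψ y ≤ φ x - ψ x := hx ⟨hy, hye⟩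
    have h2 : φ y ≤ ψ y := by linarith
    exact h2
  have hb : 0 ≤ (2 * M / d ^ 2 * n + N') * (inner ℝ e x * (d - inner ℝ e x)) :=
    mul_nonneg (by have := hN0.trans hN'.le; positivity) (mul_nonneg hx0 (sub_nonneg.2 hxt))
  rcases hxd.eq_or_lt with h1 | h1
  · have h2 : φ x ≤ 2 * M := by
      have ha := abs_le.1 (hM x hxH.1)
      have hb := abs_le.1 (hM (σ x) (hσmem x hxH.1))
      simp only [hφ]
      linarith
    have h3 : 2 * M / d ^ 2 * ‖x‖ ^ 2 = 2 * M := by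
      rw [h1]; field_simp
    simp only [hψ]
    linarith
  rcases hx0.eq_or_lt with h2 | h2
  · have h3 : σ x = x := by
      refine Submodule.reflection_mem_subspace_eq_self ?_
      rw [Submodule.mem_orthogonal_singleton_iff_inner_right]
      exact h2.symm
    have h4 : φ x = 0 := by simp [hφ, h3]
    have h5 : 0 ≤ 2 * M / d ^ 2 * ‖x‖ ^ 2 := by positivity
    simp only [hψ]
    linarith
  · exfalso
    have hnhds : H ∈ nhds x := by
      refine Filter.inter_mem ?_ ?_
      · exact Metric.closedBall_mem_nhds_of_mem (by simpa using h1)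
      · have : IsOpen {y : E | 0 < inner ℝ e y} := isOpen_lt continuous_const (by fun_prop)
        exact mem_of_superset (this.mem_nhds h2) fun z (hz : 0 < inner ℝ e z) => hz.le
    have h3 := laplacian_le_of_isLocalMax_sub (hcφ x hxH.1) hcψ.contDiffAt (hx.isLocalMax hnhds)
    have h4 : Laplacian.laplacian ψ x = -2 * N' := by
      rw [hψ, laplacian_norm_sq_mul_add_inner _ _ _ he]
      ring
    have h5 : Laplacian.laplacian φ x = Laplacian.laplacian u x - Laplacian.laplacian u (σ x) := by
      rw [← laplacian_comp_linearIsometryEquiv σ x]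
      exact (hu x hxH.1).laplacian_sub (hcσ x hxH.1)
    have ha := abs_le.1 (hN x hxH.1)
    have hb := abs_le.1 (hN (σ x) (hσmem x hxH.1))
    rw [h4, h5] at h3
    linarith

/-- Along `t • e` both sides of `odd_part_le_barrier` vanish at `t = 0`, so their derivatives there
are ordered; the left one is twice the derivative of `u` along `e`. Then `N'` tends to `N`. -/
theorem fderiv_zero_le_of_laplacian_bound {u : E → ℝ} {d M N : ℝ} (hd : 0 < d)
    (hu : ∀ y ∈ Metric.closedBall (0 : E) d, ContDiffAt ℝ 2 u y)
    (hM : ∀ y ∈ Metric.closedBall (0 : E) d, |u y| ≤ M)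
    (hN : ∀ y ∈ Metric.closedBall (0 : E) d, |Laplacian.laplacian u y| ≤ N)
    {e : E} (he : ‖e‖ = 1) :
    fderiv ℝ u 0 e ≤ Module.finrank ℝ E * M / d + N * d / 2 := by
  have h0mem : (0 : E) ∈ Metric.closedBall (0 : E) d := by simpa using hd.le
  have hdiff : DifferentiableAt ℝ u 0 := (hu 0 h0mem).differentiableAt (by norm_num)
  have key : ∀ N' > N, fderiv ℝ u 0 e ≤ Module.finrank ℝ E * M / d + N' * d / 2 := by
    intro N' hN'
    set n : ℝ := (Module.finrank ℝ E : ℝ) with hn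
    have h1 : HasDerivAt (fun t : ℝ => u (t • e)) (fderiv ℝ u 0 e) 0 := by
      have := hasDerivAt_comp_line (f := u) (x := 0) (v := e) (t := 0) (by simpa using hdiff)
      simpa using this
    have h2 : HasDerivAt (fun t : ℝ => u (t • -e)) (-fderiv ℝ u 0 e) 0 := by
      have := hasDerivAt_comp_line (f := u) (x := 0) (v := -e) (t := 0) (by simpa using hdiff)
      simpa using this
    have h3 := hasDerivAt_quadratic 0 (2 * M / d ^ 2 * n * d + N' * d)
      (2 * M / d ^ 2 - (2 * M / d ^ 2 * n + N')) 0
    have h4 := h3.sub (h1.sub h2)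
    have h5 := h4.nonneg_of_nonneg_right (by simp) hd ?_
    · have h6 : 2 * M / d ^ 2 * n * d = 2 * (n * M / d) := by field_simp
      rw [h6] at h5
      linarith
    · intro t ht0 htd
      have hin : inner ℝ e (t • e) = t := by
        rw [inner_smul_right, real_inner_self_eq_norm_sq, he]; ring
      have hnorm : ‖t • e‖ = t := by rw [norm_smul, he, Real.norm_of_nonneg ht0.le, mul_one]
      have h6 := odd_part_le_barrier hd hu hM hN hN' he (y := t • e)
        (by simpa [hnorm] using htd.le) (by rw [hin]; exact ht0.le)
      have h7 : (ℝ ∙ e)ᗮ.reflection (t • e) = t • -e := by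
        rw [map_smul, Submodule.reflection_orthogonalComplement_singleton_eq_neg]
      rw [h7, hin, hnorm] at h6
      simp only [Pi.sub_apply]
      linarith
  have hlim : Tendsto (fun N' : ℝ => Module.finrank ℝ E * M / d + N' * d / 2) (nhdsWithin N (Ioi N))
      (nhds (Module.finrank ℝ E * M / d + N * d / 2)) := by
    refine Tendsto.mono_left (Continuous.tendsto ?_ N) nhdsWithin_le_nhds
    fun_prop
  exact ge_of_tendsto hlim (eventually_mem_nhdsWithin.mono fun N' h => key N' h)

/-- Interior gradient estimate for the Poisson equation. -/
theorem norm_fderiv_le_of_laplacian_bound {u : E → ℝ} {c : E} {d M N : ℝ} (hd : 0 < d)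
    (hu : ∀ y ∈ Metric.closedBall c d, ContDiffAt ℝ 2 u y)
    (hM : ∀ y ∈ Metric.closedBall c d, |u y| ≤ M)
    (hN : ∀ y ∈ Metric.closedBall c d, |Laplacian.laplacian u y| ≤ N) :
    ‖fderiv ℝ u c‖ ≤ Module.finrank ℝ E * M / d + N * d / 2 := by
  have hc : c ∈ Metric.closedBall c d := Metric.mem_closedBall_self hd.le
  have hM0 : 0 ≤ M := (abs_nonneg _).trans (hM c hc)
  have hN0 : 0 ≤ N := (abs_nonneg _).trans (hN c hc)
  have hmem : ∀ y ∈ Metric.closedBall (0 : E) d, c + y ∈ Metric.closedBall c d := by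
    intro y hy
    simpa using hy
  have hunit : ∀ e : E, ‖e‖ = 1 →
      fderiv ℝ u c e ≤ Module.finrank ℝ E * M / d + N * d / 2 := by
    intro e he
    have := fderiv_zero_le_of_laplacian_bound (u := fun y => u (c + y)) (M := M) (N := N) hd
      (fun y hy => (hu _ (hmem y hy)).comp y (by fun_prop)) (fun y hy => hM _ (hmem y hy))
      (fun y hy => by rw [laplacian_comp_add_left]; exact hN _ (hmem y hy)) he
    rwa [fderiv_comp_add_left, add_zero] at this
  refine ContinuousLinearMap.opNorm_le_of_unit_norm (by positivity) fun e he => ?_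
  rw [Real.norm_eq_abs, abs_le]
  refine ⟨?_, hunit e he⟩
  have := hunit (-e) (by simpa using he)
  rw [map_neg] at this
  linarith

end GradientEstimate

/-! ### Point selection and small energy regularity -/

section Concentration

variable {E : Type*} [NormedAddCommGroup E] [InnerProductSpace ℝ E] [FiniteDimensional ℝ E]

/-- The gradient estimate on balls of radius `r / 2` bounds the Lipschitz constant of `u` near `c`;
over the distance `ρ` the value drops by at most `b / 2`. -/
theorem half_le_of_laplacian_bound {u : E → ℝ} {c : E} {r ρ b M N : ℝ} (hr : 0 < r) (hρ : ρ ≤ r / 2)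
    (hu : ∀ y ∈ Metric.closedBall c r, ContDiffAt ℝ 2 u y)
    (hM : ∀ y ∈ Metric.closedBall c r, |u y| ≤ M)
    (hN : ∀ y ∈ Metric.closedBall c r, |Laplacian.laplacian u y| ≤ N)
    (hb : u c = b)
    (hL : (Module.finrank ℝ E * M / (r / 2) + N * (r / 2) / 2) * ρ ≤ b / 2) :
    ∀ y ∈ Metric.closedBall c ρ, b / 2 ≤ u y := by
  intro y hy
  have hρ0 : 0 ≤ ρ := dist_nonneg.trans (Metric.mem_closedBall.1 hy)
  have hsub : Metric.closedBall c ρ ⊆ Metric.closedBall c r :=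
    Metric.closedBall_subset_closedBall (by linarith)
  have hsub' : ∀ z ∈ Metric.closedBall c ρ,
      Metric.closedBall z (r / 2) ⊆ Metric.closedBall c r := by
    intro z hz
    exact Metric.closedBall_subset_closedBall' (by linarith [Metric.mem_closedBall.1 hz])
  have h := (convex_closedBall c ρ).norm_image_sub_le_of_norm_fderiv_le (𝕜 := ℝ)
    (fun z hz => (hu z (hsub hz)).differentiableAt (by norm_num))
    (fun z hz => norm_fderiv_le_of_laplacian_bound (half_pos hr)
      (fun w hw => hu w (hsub' z hz hw)) (fun w hw => hM w (hsub' z hz hw))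
      (fun w hw => hN w (hsub' z hz hw))) (Metric.mem_closedBall_self hρ0) hy
  have hc : c ∈ Metric.closedBall c r := Metric.mem_closedBall_self hr.le
  have hM0 : 0 ≤ M := (abs_nonneg _).trans (hM c hc)
  have hN0 : 0 ≤ N := (abs_nonneg _).trans (hN c hc)
  have h1 : ‖y - c‖ ≤ ρ := by rw [← dist_eq_norm]; exact Metric.mem_closedBall.1 hy
  have h2 := h.trans (mul_le_mul_of_nonneg_left h1 (by positivity))
  rw [Real.norm_eq_abs, hb] at h2
  linarith [(abs_le.1 (h2.trans hL)).1]

variable {F : Type*} [NormedAddCommGroup F] [InnerProductSpace ℝ F]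

/-- Point selection: `x` maximises `(D - dist y c) * ‖V y‖ ^ s` and `b = ‖V x‖`. Within `δ / 2 * b ^
(-s)` of `x` the first factor at least halves nothing beyond one half, so `‖V‖ ≤ 2 ^ (1 / s) * b`
there. The component of `V` along `V x` then stays above `b / 2` on a smaller ball. The radii are
the natural length scale of a solution of size `b`. -/
theorem norm_lower_bound_of_large {V : E → F} {c : E} {D s C δ κ : ℝ} (hs : 0 < s) (hC : 0 ≤ C)
    (hδ : 0 < δ) (hκ : 0 < κ) (hκδ : κ ≤ δ / 4)
    (hκL : (4 * Module.finrank ℝ E * 2 ^ (1 / s) / δ + C * (2 ^ (1 / s)) ^ (1 + 2 * s) * δ / 8) * κ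
      ≤ 1 / 2)
    (hD : 0 < D)
    (hV : ∀ y ∈ Metric.closedBall c D, ContDiffAt ℝ 2 V y)
    (hΔ : ∀ y ∈ Metric.closedBall c D, ∀ e : F, ‖e‖ = 1 →
      |Laplacian.laplacian (fun z => inner ℝ e (V z)) y| ≤ C * ‖V y‖ ^ (1 + 2 * s))
    (hlarge : δ < D * ‖V c‖ ^ s) :
    ∃ x b, 0 < b ∧ Metric.closedBall x (κ * b ^ (-s)) ⊆ Metric.closedBall c D ∧
      ∀ y ∈ Metric.closedBall x (κ * b ^ (-s)), b / 2 ≤ ‖V y‖ := by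
  set M₀ : ℝ := 2 ^ (1 / s) with hM₀
  have hM₀pos : 0 < M₀ := by positivity
  have hcont : ContinuousOn (fun y => (D - dist y c) * ‖V y‖ ^ s) (Metric.closedBall c D) := by
    intro y hy
    have h1 : ContinuousAt V y := (hV y hy).continuousAt
    have h2 : ContinuousAt (fun y => ‖V y‖ ^ s) y := h1.norm.rpow_const (Or.inr hs.le)
    have h3 : ContinuousAt (fun y => D - dist y c) y := by fun_prop
    exact (h3.mul h2).continuousWithinAt
  have hcmem : c ∈ Metric.closedBall c D := Metric.mem_closedBall_self hD.le
  obtain ⟨x, hx, hmax⟩ := (isCompact_closedBall c D).exists_isMaxOn ⟨c, hcmem⟩ hcont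
  have hxD : dist x c ≤ D := hx
  have hbig : δ < (D - dist x c) * ‖V x‖ ^ s := by
    have : (D - dist c c) * ‖V c‖ ^ s ≤ (D - dist x c) * ‖V x‖ ^ s := hmax hcmem
    rw [dist_self, sub_zero] at this
    exact hlarge.trans_le this
  set b := ‖V x‖ with hb
  set d := D - dist x c with hd
  have hb0 : 0 < b := by
    rcases (norm_nonneg (V x)).eq_or_lt with h | h
    · rw [← hb] at h
      rw [← h, Real.zero_rpow hs.ne', mul_zero] at hbig
      linarith
    · exact h
  have hbs : 0 < b ^ s := by positivity
  have hbinv : b ^ (-s) = (b ^ s)⁻¹ := Real.rpow_neg hb0.le s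
  set r := δ / 2 * b ^ (-s) with hr
  have hr0 : 0 < r := by positivity
  have hrd : r ≤ d / 2 := by
    rw [hr, hbinv, ← div_eq_mul_inv, div_le_iff₀ hbs]
    linarith
  have hsub : Metric.closedBall x r ⊆ Metric.closedBall c D :=
    Metric.closedBall_subset_closedBall' (by linarith)
  have hρr : κ * b ^ (-s) ≤ r / 2 := by
    rw [hr, show δ / 2 * b ^ (-s) / 2 = δ / 4 * b ^ (-s) by ring]
    gcongr
  have hVb : ∀ y ∈ Metric.closedBall x r, ‖V y‖ ≤ M₀ * b := by
    intro y hy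
    have h1 : (D - dist y c) * ‖V y‖ ^ s ≤ d * b ^ s := hmax (hsub hy)
    have h2 : d / 2 ≤ D - dist y c := by
      have := dist_triangle y x c
      have := Metric.mem_closedBall.1 hy
      linarith
    have hd0 : 0 < d := by linarith
    have h3 : ‖V y‖ ^ s ≤ 2 * b ^ s := by
      have h4 : d / 2 * ‖V y‖ ^ s ≤ d * b ^ s :=
        (mul_le_mul_of_nonneg_right h2 (by positivity)).trans h1
      have h5 : d * ‖V y‖ ^ s ≤ d * (2 * b ^ s) := by linarith
      exact le_of_mul_le_mul_left h5 hd0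
    have h6 : (M₀ * b) ^ s = 2 * b ^ s := by
      rw [Real.mul_rpow hM₀pos.le hb0.le, hM₀, ← Real.rpow_mul (by norm_num),
        one_div_mul_cancel hs.ne', Real.rpow_one]
    rw [← h6] at h3
    exact (Real.rpow_le_rpow_iff (norm_nonneg _) (by positivity) hs).1 h3
  set e : F := b⁻¹ • V x with he
  have he1 : ‖e‖ = 1 := by
    rw [he, norm_smul, norm_inv, Real.norm_of_nonneg hb0.le]
    exact inv_mul_cancel₀ hb0.ne'
  have hex : inner ℝ e (V x) = b := by
    rw [he, real_inner_smul_left, real_inner_self_eq_norm_sq, ← hb]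
    field_simp
  have hle : ∀ y, |inner ℝ e (V y)| ≤ ‖V y‖ := by
    intro y
    have := abs_real_inner_le_norm e (V y)
    rwa [he1, one_mul] at this
  refine ⟨x, b, hb0, fun y hy => hsub (Metric.closedBall_subset_closedBall (by linarith) hy),
    fun y hy => ?_⟩
  refine (half_le_of_laplacian_bound (u := fun z => inner ℝ e (V z)) (M := M₀ * b)
    (N := C * (M₀ * b) ^ (1 + 2 * s)) hr0 hρr
    (fun z hz => contDiffAt_const.inner ℝ (hV z (hsub hz)))
    (fun z hz => (hle z).trans (hVb z hz)) (fun z hz => ?_) hex ?_ y hy).trans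
    ((le_abs_self _).trans (hle y))
  · refine (hΔ z (hsub hz) e he1).trans ?_
    gcongr
    exact hVb z hz
  · have h7 : (M₀ * b) ^ (1 + 2 * s) = M₀ ^ (1 + 2 * s) * (b * (b ^ s * b ^ s)) := by
      rw [Real.mul_rpow hM₀pos.le hb0.le, Real.rpow_add hb0, Real.rpow_one, two_mul,
        Real.rpow_add hb0]
    rw [h7, hr, hbinv]
    -- By scale invariance all powers of `b` cancel except the factor `b` itself, leaving `hκL`.
    have h8 : (Module.finrank ℝ E * (M₀ * b) / (δ / 2 * (b ^ s)⁻¹ / 2) +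
        C * (M₀ ^ (1 + 2 * s) * (b * (b ^ s * b ^ s))) * (δ / 2 * (b ^ s)⁻¹ / 2) / 2) *
        (κ * (b ^ s)⁻¹) = ((4 * Module.finrank ℝ E * M₀ / δ + C * M₀ ^ (1 + 2 * s) * δ / 8) * κ)
          * b := by
      field_simp
      ring
    rw [h8]
    calc _ ≤ 1 / 2 * b := by gcongr
      _ = b / 2 := by ring

variable [MeasurableSpace E] [BorelSpace E]

/-- Small energy regularity: if the scale invariant energy of `V` is small in a ball, then
`V` is small at its centre. -/
theorem exists_energy_threshold [Nontrivial E] {s C δ p : ℝ} (hs : 0 < s) (hC : 0 ≤ C) (hδ : 0 < δ)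
    (hp : p = Module.finrank ℝ E * s) :
    ∃ ε : ENNReal, 0 < ε ∧ ∀ (V : E → F) (c : E) (D : ℝ), 0 < D →
      (∀ y ∈ Metric.closedBall c D, ContDiffAt ℝ 2 V y) →
      (∀ y ∈ Metric.closedBall c D, ∀ e : F, ‖e‖ = 1 →
        |Laplacian.laplacian (fun z => inner ℝ e (V z)) y| ≤ C * ‖V y‖ ^ (1 + 2 * s)) →
      ∫⁻ y in Metric.closedBall c D, ‖V y‖ₑ ^ p < ε → D * ‖V c‖ ^ s ≤ δ := by
  set L : ℝ := 4 * Module.finrank ℝ E * 2 ^ (1 / s) / δ + C * (2 ^ (1 / s)) ^ (1 + 2 * s) * δ / 8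
    with hL
  have hL0 : 0 ≤ L := by positivity
  have hn : 0 < Module.finrank ℝ E := Module.finrank_pos
  have hp0 : 0 < p := by rw [hp]; positivity
  -- Small enough for both `κ ≤ δ / 4` and `κ ≤ 1 / (2 L)`.
  set κ : ℝ := 1 / (4 / δ + 2 * L) with hκ
  have hκ0 : 0 < κ := by positivity
  have hκδ : κ ≤ δ / 4 := by
    rw [hκ, div_le_div_iff₀ (by positivity) (by norm_num), one_mul, mul_add, mul_div_cancel₀ _ hδ.ne']
    have : 0 ≤ δ * (2 * L) := by positivity
    linarith
  have hκL : L * κ ≤ 1 / 2 := by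
    rw [hκ, mul_one_div, div_le_div_iff₀ (by positivity) (by norm_num)]
    have : 0 ≤ 4 / δ := by positivity
    linarith
  refine ⟨ENNReal.ofReal ((1 / 2) ^ p * κ ^ Module.finrank ℝ E) *
    volume (Metric.ball (0 : E) 1), ?_, ?_⟩
  · refine ENNReal.mul_pos (ENNReal.ofReal_pos.2 (by positivity)).ne' ?_
    exact (Metric.measure_ball_pos volume (0 : E) one_pos).ne'
  intro V c D hD hV hΔ hint
  by_contra! hlarge
  obtain ⟨x, b, hb, hsub, hlow⟩ := norm_lower_bound_of_large hs hC hδ hκ0 hκδ hκL hD hV hΔ hlarge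
  refine hint.not_ge ?_
  -- Energy of the concentration ball: since `p = n s`, it has a lower bound independent of `b`,
  -- which is the threshold `ε`.
  have hmul : (b / 2) ^ p * (κ * b ^ (-s)) ^ Module.finrank ℝ E =
      (1 / 2) ^ p * κ ^ Module.finrank ℝ E := by
    have h1 : (b ^ (-s)) ^ Module.finrank ℝ E = (b ^ p)⁻¹ := by
      rw [← Real.rpow_natCast, ← Real.rpow_mul hb.le, ← Real.rpow_neg hb.le, hp]
      congr 1
      ring
    rw [mul_pow, h1, div_eq_mul_one_div b 2, Real.mul_rpow hb.le (by norm_num)]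
    have : 0 < b ^ p := by positivity
    field_simp
  calc ENNReal.ofReal ((1 / 2) ^ p * κ ^ Module.finrank ℝ E) * volume (Metric.ball (0 : E) 1)
      = ENNReal.ofReal ((b / 2) ^ p) * volume (Metric.closedBall x (κ * b ^ (-s))) := by
        rw [Measure.addHaar_closedBall _ _ (by positivity), ← mul_assoc,
          ← ENNReal.ofReal_mul (by positivity), hmul]
    _ = ∫⁻ y in Metric.closedBall x (κ * b ^ (-s)), ENNReal.ofReal ((b / 2) ^ p) := by
        rw [setLIntegral_const]
    _ ≤ ∫⁻ y in Metric.closedBall x (κ * b ^ (-s)), ‖V y‖ₑ ^ p := by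
        refine setLIntegral_mono' Metric.isClosed_closedBall.measurableSet fun y hy => ?_
        rw [← ofReal_norm, ENNReal.ofReal_rpow_of_nonneg (norm_nonneg _) hp0.le]
        refine ENNReal.ofReal_le_ofReal (Real.rpow_le_rpow (by positivity) (hlow y hy) hp0.le)
    _ ≤ ∫⁻ y in Metric.closedBall c D, ‖V y‖ₑ ^ p := lintegral_mono_set hsub

-- Continuity from above of the finite measure with density `g`, along exteriors of balls.
omit [InnerProductSpace ℝ E] [FiniteDimensional ℝ E] in
theorem exists_setLIntegral_norm_ge_lt {μ : Measure E} {g : E → ENNReal}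
    (hg : ∫⁻ x, g x ∂μ ≠ ⊤) {ε : ENNReal} (hε : 0 < ε) :
    ∃ R : ℝ, ∫⁻ x in {x | R ≤ ‖x‖}, g x ∂μ < ε := by
  have hmeas : ∀ k : ℕ, MeasurableSet {x : E | (k : ℝ) ≤ ‖x‖} := fun k =>
    measurableSet_le measurable_const measurable_norm
  have hanti : Antitone fun k : ℕ => {x : E | (k : ℝ) ≤ ‖x‖} := by
    intro i j hij x (hx : (j : ℝ) ≤ ‖x‖)
    exact le_trans (Nat.cast_le.2 hij) hx
  have hempty : ⋂ k : ℕ, {x : E | (k : ℝ) ≤ ‖x‖} = ∅ := by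
    refine eq_empty_iff_forall_notMem.2 fun x hx => ?_
    obtain ⟨k, hk⟩ := exists_nat_gt ‖x‖
    exact absurd (mem_iInter.1 hx k) (not_le.2 hk)
  have h := tendsto_measure_iInter_atTop (μ := μ.withDensity g)
    (fun k => (hmeas k).nullMeasurableSet) hanti
    ⟨0, by
      rw [withDensity_apply _ (hmeas 0)]
      exact ((setLIntegral_le_lintegral _ _).trans_lt hg.lt_top).ne⟩
  rw [hempty, measure_empty] at h
  obtain ⟨k, hk⟩ := (h.eventually (gt_mem_nhds hε)).exists
  refine ⟨k, ?_⟩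
  rwa [Function.comp_apply, withDensity_apply _ (hmeas k)] at hk

end Concentration

/-! ### Comparison with radial supersolutions and decay rates -/

section Comparison

variable {E : Type*} [NormedAddCommGroup E] [InnerProductSpace ℝ E] [FiniteDimensional ℝ E]
  {F : Type*} [NormedAddCommGroup F] [InnerProductSpace ℝ F]

/-- Comparison with a positive supersolution in an exterior domain. -/
theorem norm_le_of_supersolution {V : E → F} {w : E → ℝ} {R : ℝ}
    (hV : ∀ y, R ≤ ‖y‖ → ContDiffAt ℝ 2 V y) (hw : ∀ y, R ≤ ‖y‖ → ContDiffAt ℝ 2 w y)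
    (hpos : ∀ y, R ≤ ‖y‖ → 0 < w y) (hbd : ∀ y, ‖y‖ = R → ‖V y‖ ≤ w y)
    (hinf : ∀ᶠ y in Bornology.cobounded E, ‖V y‖ ≤ w y)
    (hΔ : ∀ y, R < ‖y‖ → w y < ‖V y‖ → ∀ e : F, ‖e‖ = 1 →
      |Laplacian.laplacian (fun z => inner ℝ e (V z)) y| * w y
        < -Laplacian.laplacian w y * ‖V y‖) :
    ∀ y, R ≤ ‖y‖ → ‖V y‖ ≤ w y := by
  intro y hy
  by_contra! hlt
  obtain ⟨R₁, -, hR₁⟩ := (hasBasis_cobounded_norm (E := E)).eventually_iff.1 hinf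
  have hyR₁ : ‖y‖ < R₁ := by
    by_contra! h
    exact absurd (hR₁ h) (not_le.2 hlt)
  set S : Set E := Metric.closedBall 0 R₁ ∩ {z | R ≤ ‖z‖} with hS
  have hcomp : IsCompact S :=
    (isCompact_closedBall 0 R₁).inter_right (isClosed_le continuous_const continuous_norm)
  have hcont : ContinuousOn (fun z => ‖V z‖ / w z) S := fun z hz =>
    ((hV z hz.2).continuousAt.norm.div (hw z hz.2).continuousAt
      (hpos z hz.2).ne').continuousWithinAt
  have hyS : y ∈ S := ⟨by simpa using hyR₁.le, hy⟩
  obtain ⟨x, hxS, hmax⟩ := hcomp.exists_isMaxOn ⟨y, hyS⟩ hcont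
  have hxR : R ≤ ‖x‖ := hxS.2
  have hwx := hpos x hxR
  -- If the bound fails, the maximal ratio `l` exceeds `1`, so it is attained strictly inside the
  -- annulus.
  set l := ‖V x‖ / w x with hl
  have hle : ∀ z ∈ S, ‖V z‖ ≤ l * w z := by
    intro z hz
    have : ‖V z‖ / w z ≤ l := hmax hz
    rwa [div_le_iff₀ (hpos z hz.2)] at this
  have hl1 : 1 < l := by
    have h1 := hlt.trans_le (hle y hyS)
    exact (lt_mul_iff_one_lt_left (hpos y hy)).1 h1
  have hVx : w x < ‖V x‖ := by rwa [hl, one_lt_div hwx] at hl1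
  have hxR' : R < ‖x‖ := by
    refine hxR.lt_of_ne fun h => ?_
    exact absurd (hbd x h.symm) (not_le.2 hVx)
  have hxR₁ : ‖x‖ < R₁ := by
    by_contra! h
    exact absurd (hR₁ h) (not_le.2 hVx)
  have hnhds : S ∈ nhds x := by
    refine Filter.inter_mem (Metric.closedBall_mem_nhds_of_mem (by simpa using hxR₁)) ?_
    have : IsOpen {z : E | R < ‖z‖} := isOpen_lt continuous_const continuous_norm
    exact mem_of_superset (this.mem_nhds hxR') fun z (hz : R < ‖z‖) => hz.le
  have hV0 : 0 < ‖V x‖ := hwx.trans hVx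
  set e : F := ‖V x‖⁻¹ • V x with he
  have he1 : ‖e‖ = 1 := by
    rw [he, norm_smul, norm_inv, norm_norm]
    exact inv_mul_cancel₀ hV0.ne'
  have hex : inner ℝ e (V x) = ‖V x‖ := by
    rw [he, real_inner_smul_left, real_inner_self_eq_norm_sq]
    field_simp
  have hlw : l * w x = ‖V x‖ := div_mul_cancel₀ _ hwx.ne'
  -- With `e` the direction of `V x`, the scalar `⟪e, V⟫` lies below `l • w` and touches it at `x`.
  -- This is how a vector-valued `V` admits a maximum principle.
  have hloc : IsLocalMax ((fun z => inner ℝ e (V z)) - l • w) x := by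
    filter_upwards [hnhds] with z hz
    have h1 : inner ℝ e (V z) ≤ ‖V z‖ := by
      have := real_inner_le_norm e (V z)
      rwa [he1, one_mul] at this
    simp only [Pi.sub_apply, Pi.smul_apply, smul_eq_mul, hex, hlw, sub_self]
    linarith [hle z hz]
  have h1 := laplacian_le_of_isLocalMax_sub (contDiffAt_const.inner ℝ (hV x hxR))
    ((hw x hxR).const_smul l) hloc
  have h2 : Laplacian.laplacian (fun y => l • w y) x = l * Laplacian.laplacian w x :=
    InnerProductSpace.laplacian_smul l (hw x hxR)
  rw [h2] at h1
  have h3 := hΔ x hxR' hVx e he1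
  have h4 := neg_abs_le (Laplacian.laplacian (fun z => inner ℝ e (V z)) x)
  rw [← hlw] at h3
  have h5 : |Laplacian.laplacian (fun z => inner ℝ e (V z)) x| <
      -Laplacian.laplacian w x * l := by
    refine lt_of_mul_lt_mul_right ?_ hwx.le
    linarith
  linarith

omit [FiniteDimensional ℝ E] in
theorem contDiffAt_two_powers (a b c σ τ : ℝ) {x : E} (hx : x ≠ 0) :
    ContDiffAt ℝ 2 (fun y : E => a * ‖y‖ ^ σ + b * ‖y‖ ^ τ + c) x :=
  ((contDiffAt_const.mul (contDiffAt_norm_rpow σ hx)).add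
    (contDiffAt_const.mul (contDiffAt_norm_rpow τ hx))).add contDiffAt_const

theorem laplacian_two_powers (a b c σ τ : ℝ) {x : E} (hx : x ≠ 0) :
    Laplacian.laplacian (fun y : E => a * ‖y‖ ^ σ + b * ‖y‖ ^ τ + c) x =
      a * (σ * (σ + Module.finrank ℝ E - 2) * ‖x‖ ^ (σ - 2)) +
      b * (τ * (τ + Module.finrank ℝ E - 2) * ‖x‖ ^ (τ - 2)) := by
  have h1 := contDiffAt_norm_rpow σ hx
  have h2 := contDiffAt_norm_rpow τ hx
  have h3 : (fun y : E => a * ‖y‖ ^ σ + b * ‖y‖ ^ τ + c) =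
      (a • (fun y : E => ‖y‖ ^ σ) + b • (fun y : E => ‖y‖ ^ τ)) + fun _ => c := by
    funext y
    simp
  have h1' : ContDiffAt ℝ 2 (a • (fun y : E => ‖y‖ ^ σ)) x := h1.const_smul a
  have h2' : ContDiffAt ℝ 2 (b • (fun y : E => ‖y‖ ^ τ)) x := h2.const_smul b
  have h12 : ContDiffAt ℝ 2 (a • (fun y : E => ‖y‖ ^ σ) + b • (fun y : E => ‖y‖ ^ τ)) x :=
    h1'.add h2'
  rw [h3, h12.laplacian_add contDiffAt_const, h1'.laplacian_add h2',
    InnerProductSpace.laplacian_smul a h1, InnerProductSpace.laplacian_smul b h2,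
    InnerProductSpace.laplacian_const, laplacian_norm_rpow σ hx, laplacian_norm_rpow τ hx]
  simp

omit [InnerProductSpace ℝ E] [FiniteDimensional ℝ E] in
theorem eventually_le_norm (R : ℝ) : ∀ᶠ y in Bornology.cobounded E, R ≤ ‖y‖ :=
  tendsto_norm_cobounded_atTop.eventually_ge_atTop R

theorem le_mul_rpow_of_mul_rpow_le {a t s η : ℝ} (hs : 0 < s) (ht : 0 < t) (ha : 0 ≤ a)
    (hη : 0 ≤ η) (h : t * a ^ s ≤ η ^ s) : a ≤ η * t ^ (-(1 / s)) := by
  have h1 : (η * t ^ (-(1 / s))) ^ s = η ^ s * t⁻¹ := by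
    rw [Real.mul_rpow hη (by positivity), ← Real.rpow_mul ht.le, neg_mul,
      one_div_mul_cancel hs.ne', Real.rpow_neg_one]
  rw [← Real.rpow_le_rpow_iff ha (by positivity) hs, h1, ← div_eq_mul_inv, le_div_iff₀ ht]
  linarith

/-- Subcritical power decay for solutions of `|ΔV| ≤ C |V| ^ (1 + 2 s)`. -/
theorem exists_power_decay {V : E → F} {s C α : ℝ} (hs : 0 < s) (hC : 0 ≤ C)
    (hV : ∀ᶠ y in Bornology.cobounded E, ContDiffAt ℝ 2 V y)
    (hΔ : ∀ᶠ y in Bornology.cobounded E, ∀ e : F, ‖e‖ = 1 →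
      |Laplacian.laplacian (fun z => inner ℝ e (V z)) y| ≤ C * ‖V y‖ ^ (1 + 2 * s))
    (hdecay : ∀ δ > 0, ∀ᶠ y in Bornology.cobounded E, ‖y‖ * ‖V y‖ ^ s ≤ δ)
    (hα0 : 0 < α) (hα : α < Module.finrank ℝ E - 2)
    (hβ : 1 / s < Module.finrank ℝ E - 2) :
    ∃ M, 0 ≤ M ∧ ∀ᶠ y in Bornology.cobounded E, ‖V y‖ ≤ M * ‖y‖ ^ (-α) := by
  set n : ℝ := (Module.finrank ℝ E : ℝ) with hn
  set β := 1 / s with hβs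
  have hβ0 : 0 < β := by positivity
  -- These products are the coefficients in `-Δ|y|^(-α) = α(n-2-α)|y|^(-α-2)` and its analogue for
  -- `β`.
  obtain ⟨ε, hε0, hεα, hεβ⟩ : ∃ ε, 0 < ε ∧ ε < α * (n - 2 - α) ∧ ε < β * (n - 2 - β) := by
    have h1 : 0 < min (α * (n - 2 - α)) (β * (n - 2 - β)) :=
      lt_min (mul_pos hα0 (by linarith)) (mul_pos hβ0 (by linarith))
    obtain ⟨ε, h2, h3⟩ := exists_between h1
    exact ⟨ε, h2, lt_min_iff.1 h3⟩
  -- Makes `C ‖V y‖ ^ (2 s) ≤ ε |y|⁻²` far out.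
  set δ := Real.sqrt (ε / (C + 1)) with hδ
  have hδ0 : 0 < δ := Real.sqrt_pos.2 (by positivity)
  have hCδ : C * δ ^ 2 ≤ ε := by
    rw [hδ, Real.sq_sqrt (by positivity), mul_div_assoc', div_le_iff₀ (by positivity)]
    linarith
  obtain ⟨R, -, hR⟩ := (hasBasis_cobounded_norm (E := E)).eventually_iff.1
    (hV.and (hΔ.and ((hdecay δ hδ0).and (eventually_le_norm 1))))
  have hR1 : ∀ y : E, R ≤ ‖y‖ → 1 ≤ ‖y‖ := fun y hy => (hR hy).2.2.2
  have hne : ∀ y : E, R ≤ ‖y‖ → y ≠ 0 := fun y hy =>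
    norm_pos_iff.1 (zero_lt_one.trans_le (hR1 y hy))
  have hbound : ∀ y : E, R ≤ ‖y‖ → ‖V y‖ ≤ δ ^ β := by
    intro y hy
    have h1 := (hR hy).2.2.1
    have h2 : ‖y‖ * ‖V y‖ ^ s ≤ (δ ^ β) ^ s := by
      rwa [← Real.rpow_mul hδ0.le, hβs, one_div_mul_cancel hs.ne', Real.rpow_one]
    have h3 : 1 * ‖V y‖ ^ s ≤ (δ ^ β) ^ s :=
      (mul_le_mul_of_nonneg_right (hR1 y hy) (by positivity)).trans h2
    rw [one_mul] at h3
    exact (Real.rpow_le_rpow_iff (norm_nonneg _) (by positivity) hs).1 h3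
  set M := δ ^ β * (max R 1) ^ α with hM
  have hM0 : 0 < M := by positivity
  refine ⟨M, hM0.le, ?_⟩
  -- `M` handles the sphere `‖y‖ = R`. The term with `η` handles infinity, because `hdecay` says `‖V
  -- y‖ = o(‖y‖ ^ (-β))`; it disappears as `η → 0`.
  have key : ∀ η > 0, ∀ y : E, R ≤ ‖y‖ → ‖V y‖ ≤ M * ‖y‖ ^ (-α) + η * ‖y‖ ^ (-β) + 0 := by
    intro η hη
    refine norm_le_of_supersolution (fun y hy => (hR hy).1)
      (fun y hy => contDiffAt_two_powers M η 0 (-α) (-β) (hne y hy)) ?_ ?_ ?_ ?_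
    · intro y hy
      have := norm_pos_iff.2 (hne y hy)
      positivity
    · intro y hy
      have hy1 := hR1 y hy.ge
      have h0 : max R 1 = ‖y‖ := by rw [← hy, max_eq_left hy1]
      have h1 : M * ‖y‖ ^ (-α) = δ ^ β := by
        have : 0 < ‖y‖ := by linarith
        rw [hM, h0, mul_assoc, ← Real.rpow_add this, add_neg_cancel, Real.rpow_zero, mul_one]
      have h2 : 0 ≤ η * ‖y‖ ^ (-β) := by positivity
      linarith [hbound y hy.ge]
    · filter_upwards [hdecay (η ^ s) (by positivity), eventually_le_norm 1] with y hy hy1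
      have h1 := le_mul_rpow_of_mul_rpow_le hs (by linarith) (norm_nonneg (V y)) hη.le hy
      have h2 : 0 ≤ M * ‖y‖ ^ (-α) := by positivity
      linarith
    · intro y hy hwV e he
      have hyR := hy.le
      have hy0 : 0 < ‖y‖ := norm_pos_iff.2 (hne y hyR)
      set w := M * ‖y‖ ^ (-α) + η * ‖y‖ ^ (-β) + 0 with hw
      have hw0 : 0 < w := by positivity
      have hV0 : 0 < ‖V y‖ := hw0.trans hwV
      have h1 : |Laplacian.laplacian (fun z => inner ℝ e (V z)) y| ≤ ε * ‖y‖ ^ (-2 : ℝ) * ‖V y‖ := by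
        refine ((hR hyR).2.1 e he).trans ?_
        have h2 : ‖V y‖ ^ (1 + 2 * s) = ‖V y‖ * (‖V y‖ ^ s) ^ 2 := by
          rw [Real.rpow_add hV0, Real.rpow_one, two_mul, Real.rpow_add hV0, sq]
        have h3 : ‖V y‖ ^ s ≤ δ * ‖y‖⁻¹ := by
          rw [← div_eq_mul_inv, le_div_iff₀ hy0]
          linarith [(hR hyR).2.2.1]
        have h4 : ‖y‖ ^ (-2 : ℝ) = ‖y‖⁻¹ ^ 2 := by
          rw [Real.rpow_neg hy0.le, inv_pow]
          norm_cast
        calc C * ‖V y‖ ^ (1 + 2 * s) = C * (‖V y‖ * (‖V y‖ ^ s) ^ 2) := by rw [h2]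
          _ ≤ C * (‖V y‖ * (δ * ‖y‖⁻¹) ^ 2) := by gcongr
          _ = C * δ ^ 2 * ‖y‖⁻¹ ^ 2 * ‖V y‖ := by ring
          _ ≤ ε * ‖y‖⁻¹ ^ 2 * ‖V y‖ := by gcongr
          _ = _ := by rw [h4]
      have h5 : ε * ‖y‖ ^ (-2 : ℝ) * w < -Laplacian.laplacian
          (fun y : E => M * ‖y‖ ^ (-α) + η * ‖y‖ ^ (-β) + 0) y := by
        rw [laplacian_two_powers _ _ _ _ _ (hne y hyR)]
        have h6 : ‖y‖ ^ (-α - 2) = ‖y‖ ^ (-2 : ℝ) * ‖y‖ ^ (-α) := by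
          rw [← Real.rpow_add hy0]; ring_nf
        have h7 : ‖y‖ ^ (-β - 2) = ‖y‖ ^ (-2 : ℝ) * ‖y‖ ^ (-β) := by
          rw [← Real.rpow_add hy0]; ring_nf
        rw [h6, h7, ← hn, hw]
        have h8 : ε * (M * (‖y‖ ^ (-2 : ℝ) * ‖y‖ ^ (-α))) <
            α * (n - 2 - α) * (M * (‖y‖ ^ (-2 : ℝ) * ‖y‖ ^ (-α))) :=
          mul_lt_mul_of_pos_right hεα (by positivity)
        have h9 : ε * (η * (‖y‖ ^ (-2 : ℝ) * ‖y‖ ^ (-β))) <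
            β * (n - 2 - β) * (η * (‖y‖ ^ (-2 : ℝ) * ‖y‖ ^ (-β))) :=
          mul_lt_mul_of_pos_right hεβ (by positivity)
        linarith
      calc |Laplacian.laplacian (fun z => inner ℝ e (V z)) y| * w
          ≤ ε * ‖y‖ ^ (-2 : ℝ) * ‖V y‖ * w := by gcongr
        _ = ε * ‖y‖ ^ (-2 : ℝ) * w * ‖V y‖ := by ring
        _ < _ := mul_lt_mul_of_pos_right h5 hV0
  filter_upwards [eventually_le_norm R] with y hy
  have hy0 : 0 < ‖y‖ := norm_pos_iff.2 (hne y hy)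
  refine le_of_forall_pos_le_add fun t ht => ?_
  have h1 := key (t / ‖y‖ ^ (-β)) (by positivity) y hy
  rwa [div_mul_cancel₀ _ (by positivity), add_zero] at h1

/-- Improvement of a power decay to the decay of the fundamental solution. -/
theorem exists_fundamental_decay_of_power_decay {V : E → F} {s C α M₁ : ℝ} (hs : 0 < s)
    (hC : 0 ≤ C) (hV : ∀ᶠ y in Bornology.cobounded E, ContDiffAt ℝ 2 V y)
    (hΔ : ∀ᶠ y in Bornology.cobounded E, ∀ e : F, ‖e‖ = 1 →
      |Laplacian.laplacian (fun z => inner ℝ e (V z)) y| ≤ C * ‖V y‖ ^ (1 + 2 * s))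
    (hM₁ : 0 ≤ M₁) (hdecay : ∀ᶠ y in Bornology.cobounded E, ‖V y‖ ≤ M₁ * ‖y‖ ^ (-α))
    (hn2 : (2 : ℝ) < Module.finrank ℝ E) (hα0 : 0 < α)
    (hα : Module.finrank ℝ E < α * (1 + 2 * s)) :
    ∃ M, 0 ≤ M ∧ ∀ᶠ y in Bornology.cobounded E,
      ‖V y‖ ≤ M * ‖y‖ ^ (2 - Module.finrank ℝ E : ℝ) := by
  set n : ℝ := (Module.finrank ℝ E : ℝ) with hn
  -- The right-hand side is now `O(|y|^(-n-γ))`, a multiple of `Δ|y|^(2-n-γ)`; subtracting this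
  -- power from `|y|^(2-n)` gives the supersolution.
  set γ := α * (1 + 2 * s) - n with hγ
  have hγ0 : 0 < γ := by linarith
  obtain ⟨R₁, -, hR₁⟩ := (hasBasis_cobounded_norm (E := E)).eventually_iff.1
    (hV.and (hΔ.and hdecay))
  -- `R ≥ 2 > 1` keeps the difference of the two powers positive.
  set R := max R₁ 2 with hRdef
  have hR : ∀ y : E, R ≤ ‖y‖ → _ := fun y hy => hR₁ (show R₁ ≤ ‖y‖ from (le_max_left _ _).trans hy)
  have hR2 : 2 ≤ R := le_max_right _ _
  have hne : ∀ y : E, R ≤ ‖y‖ → y ≠ 0 := fun y hy =>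
    norm_pos_iff.1 (by linarith)
  have hgap : ∀ t : ℝ, 2 ≤ t → 0 < t ^ (2 - n) - t ^ (2 - n - γ) := fun t ht =>
    sub_pos.2 (Real.rpow_lt_rpow_of_exponent_lt (by linarith) (by linarith))
  have hgapR := hgap R hR2
  have hγn : 0 < γ * (n - 2 + γ) := mul_pos hγ0 (by linarith)
  set C₂ := C * M₁ ^ (1 + 2 * s) with hC₂
  have hC₂0 : 0 ≤ C₂ := by positivity
  -- The first summand dominates `V` on the sphere of radius `R`; the second makes the supersolution
  -- inequality strict.
  set M := M₁ * R ^ (-α) / (R ^ (2 - n) - R ^ (2 - n - γ)) + (C₂ + 1) / (γ * (n - 2 + γ)) with hM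
  have hMa : M₁ * R ^ (-α) ≤ M * (R ^ (2 - n) - R ^ (2 - n - γ)) := by
    rw [hM, add_mul, div_mul_cancel₀ _ hgapR.ne']
    have : 0 ≤ (C₂ + 1) / (γ * (n - 2 + γ)) * (R ^ (2 - n) - R ^ (2 - n - γ)) := by positivity
    linarith
  have hMb : C₂ < M * (γ * (n - 2 + γ)) := by
    rw [hM, add_mul, div_mul_cancel₀ _ hγn.ne']
    have : 0 ≤ M₁ * R ^ (-α) / (R ^ (2 - n) - R ^ (2 - n - γ)) * (γ * (n - 2 + γ)) := by positivity
    linarith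
  have hM0 : 0 < M := by positivity
  have hpos : ∀ y : E, R ≤ ‖y‖ → 0 < M * ‖y‖ ^ (2 - n) + -M * ‖y‖ ^ (2 - n - γ) := by
    intro y hy
    have := mul_pos hM0 (hgap ‖y‖ (by linarith))
    linarith
  refine ⟨M, hM0.le, ?_⟩
  have key : ∀ η > 0, ∀ y : E, R ≤ ‖y‖ →
      ‖V y‖ ≤ M * ‖y‖ ^ (2 - n) + -M * ‖y‖ ^ (2 - n - γ) + η := by
    intro η hη
    refine norm_le_of_supersolution (fun y hy => (hR y hy).1)
      (fun y hy => contDiffAt_two_powers M (-M) η _ _ (hne y hy)) ?_ ?_ ?_ ?_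
    · intro y hy
      linarith [hpos y hy]
    · intro y hy
      have h1 := (hR y hy.ge).2.2
      rw [hy] at h1 ⊢
      linarith
    · have h1 : Tendsto (fun y : E => M₁ * ‖y‖ ^ (-α)) (Bornology.cobounded E) (nhds (M₁ * 0)) :=
        ((tendsto_rpow_neg_atTop hα0).comp tendsto_norm_cobounded_atTop).const_mul M₁
      rw [mul_zero] at h1
      filter_upwards [h1.eventually (gt_mem_nhds hη), hdecay, eventually_le_norm R] with y h2 h3 h4
      linarith [hpos y h4]
    · intro y hy hwV e he
      have hyR := hy.le
      have hy0 : 0 < ‖y‖ := norm_pos_iff.2 (hne y hyR)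
      set w := M * ‖y‖ ^ (2 - n) + -M * ‖y‖ ^ (2 - n - γ) + η with hw
      have hw0 : 0 < w := by linarith [hpos y hyR]
      have h1 : |Laplacian.laplacian (fun z => inner ℝ e (V z)) y| ≤ C₂ * ‖y‖ ^ (-n - γ) := by
        refine ((hR y hyR).2.1 e he).trans ?_
        calc C * ‖V y‖ ^ (1 + 2 * s) ≤ C * (M₁ * ‖y‖ ^ (-α)) ^ (1 + 2 * s) := by
              gcongr
              exact (hR y hyR).2.2
          _ = C₂ * ‖y‖ ^ (-n - γ) := by
              rw [Real.mul_rpow hM₁ (by positivity), ← Real.rpow_mul hy0.le, hC₂, hγ]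
              ring_nf
      have h5 : -Laplacian.laplacian
          (fun y : E => M * ‖y‖ ^ (2 - n) + -M * ‖y‖ ^ (2 - n - γ) + η) y =
          M * (γ * (n - 2 + γ)) * ‖y‖ ^ (-n - γ) := by
        rw [laplacian_two_powers _ _ _ _ _ (hne y hyR), ← hn,
          show 2 - n - γ - 2 = -n - γ by ring]
        ring
      rw [h5]
      have h6 : C₂ * ‖y‖ ^ (-n - γ) < M * (γ * (n - 2 + γ)) * ‖y‖ ^ (-n - γ) :=
        mul_lt_mul_of_pos_right hMb (by positivity)
      calc |Laplacian.laplacian (fun z => inner ℝ e (V z)) y| * w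
          ≤ C₂ * ‖y‖ ^ (-n - γ) * w := by gcongr
        _ < M * (γ * (n - 2 + γ)) * ‖y‖ ^ (-n - γ) * w := mul_lt_mul_of_pos_right h6 hw0
        _ ≤ _ := by gcongr
  filter_upwards [eventually_le_norm R] with y hy
  refine le_of_forall_pos_le_add fun t ht => ?_
  have h1 := key t ht y hy
  have h2 : 0 ≤ M * ‖y‖ ^ (2 - n - γ) := by positivity
  linarith

/-- If `1 / s ≥ n - 2`, the decay `|x|^(-1/s)` already suffices. Otherwise `n < (n - 2)(1 + 2s)`,
which leaves room for an `α < n - 2` with `α (1 + 2s) > n`. -/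
theorem exists_fundamental_decay {V : E → F} {s C : ℝ} (hs : 0 < s) (hC : 0 ≤ C)
    (hV : ∀ᶠ y in Bornology.cobounded E, ContDiffAt ℝ 2 V y)
    (hΔ : ∀ᶠ y in Bornology.cobounded E, ∀ e : F, ‖e‖ = 1 →
      |Laplacian.laplacian (fun z => inner ℝ e (V z)) y| ≤ C * ‖V y‖ ^ (1 + 2 * s))
    (hdecay : ∀ δ > 0, ∀ᶠ y in Bornology.cobounded E, ‖y‖ * ‖V y‖ ^ s ≤ δ)
    (hn2 : (2 : ℝ) < Module.finrank ℝ E) :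
    ∃ M, 0 ≤ M ∧ ∀ᶠ y in Bornology.cobounded E,
      ‖V y‖ ≤ M * ‖y‖ ^ (2 - Module.finrank ℝ E : ℝ) := by
  set n : ℝ := (Module.finrank ℝ E : ℝ) with hn
  rcases le_or_gt (n - 2) (1 / s) with h | h
  · refine ⟨1, zero_le_one, ?_⟩
    filter_upwards [hdecay 1 one_pos, eventually_le_norm 1] with y hy hy1
    have hy0 : 0 < ‖y‖ := zero_lt_one.trans_le hy1
    have h1 := le_mul_rpow_of_mul_rpow_le hs hy0 (norm_nonneg (V y)) zero_le_one
      (by rwa [Real.one_rpow])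
    refine h1.trans ?_
    exact mul_le_mul_of_nonneg_left (Real.rpow_le_rpow_of_exponent_le hy1 (by linarith)) zero_le_one
  · have hq : 0 < 1 + 2 * s := by linarith
    have h1 : n / (1 + 2 * s) < n - 2 := by
      rw [div_lt_iff₀ hs] at h
      rw [div_lt_iff₀ hq]
      linarith
    obtain ⟨α, hα1, hα2⟩ := exists_between h1
    have hα0 : 0 < α := lt_trans (by positivity) hα1
    obtain ⟨M₁, hM₁, hd⟩ := exists_power_decay hs hC hV hΔ hdecay hα0 hα2 h
    refine exists_fundamental_decay_of_power_decay hs hC hV hΔ hM₁ hd hn2 hα0 ?_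
    rwa [div_lt_iff₀ hq] at hα1

/-- The gradient of each component decays one order faster. -/
theorem exists_gradient_decay {V : E → F} {s C M : ℝ} (hC : 0 ≤ C) (hM : 0 ≤ M)
    (hV : ∀ᶠ y in Bornology.cobounded E, ContDiffAt ℝ 2 V y)
    (hΔ : ∀ᶠ y in Bornology.cobounded E, ∀ e : F, ‖e‖ = 1 →
      |Laplacian.laplacian (fun z => inner ℝ e (V z)) y| ≤ C * ‖V y‖ ^ (1 + 2 * s))
    (hs : 0 < s)
    (hdecay : ∀ᶠ y in Bornology.cobounded E, ‖y‖ * ‖V y‖ ^ s ≤ 1)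
    (hn2 : (2 : ℝ) < Module.finrank ℝ E)
    (hMd : ∀ᶠ y in Bornology.cobounded E, ‖V y‖ ≤ M * ‖y‖ ^ (2 - Module.finrank ℝ E : ℝ)) :
    ∃ L, ∀ᶠ y in Bornology.cobounded E, ∀ e : F, ‖e‖ = 1 →
      ‖fderiv ℝ (fun z => inner ℝ e (V z)) y‖ ≤ L * ‖y‖ ^ (1 - Module.finrank ℝ E : ℝ) := by
  set n : ℝ := (Module.finrank ℝ E : ℝ) with hn
  obtain ⟨R, -, hR⟩ := (hasBasis_cobounded_norm (E := E)).eventually_iff.1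
    (hV.and (hΔ.and (hdecay.and hMd)))
  refine ⟨(n * M + C * M / 2) * (1 / 2) ^ (1 - n), ?_⟩
  filter_upwards [eventually_le_norm (2 * R), eventually_le_norm 1] with x hx hx1 e he
  set d := ‖x‖ / 2 with hd
  have hd0 : 0 < d := by positivity
  have hnorm : ∀ y ∈ Metric.closedBall x d, d ≤ ‖y‖ := by
    intro y hy
    have h1 : ‖x - y‖ ≤ d := by
      rw [← dist_eq_norm, dist_comm]
      exact hy
    have h2 := norm_sub_norm_le x y
    have h3 : ‖x‖ = 2 * d := by rw [hd]; ring
    linarith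
  have hR' : ∀ y ∈ Metric.closedBall x d, _ := fun y hy =>
    hR (show R ≤ ‖y‖ from (by linarith : R ≤ d).trans (hnorm y hy))
  have hbd : ∀ y ∈ Metric.closedBall x d, ‖V y‖ ≤ M * d ^ (2 - n) := by
    intro y hy
    refine (hR' y hy).2.2.2.trans ?_
    exact mul_le_mul_of_nonneg_left
      (Real.rpow_le_rpow_of_nonpos hd0 (hnorm y hy) (by linarith)) hM
  -- The scale-invariant decay turns the factor `‖V y‖ ^ (2 s)` into `d⁻¹ ^ 2`, so the bound scales
  -- as for a harmonic function.
  have hlap : ∀ y ∈ Metric.closedBall x d,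
      |Laplacian.laplacian (fun z => inner ℝ e (V z)) y| ≤ C * (M * d ^ (2 - n) * d⁻¹ ^ 2) := by
    intro y hy
    have hy0 : 0 < ‖y‖ := hd0.trans_le (hnorm y hy)
    refine ((hR' y hy).2.1 e he).trans ?_
    have h2 : ‖V y‖ ^ (1 + 2 * s) = ‖V y‖ * (‖V y‖ ^ s) ^ 2 := by
      rw [Real.rpow_add' (norm_nonneg _) (by positivity), Real.rpow_one, mul_comm 2 s,
        Real.rpow_mul (norm_nonneg _)]
      norm_cast
    have h3 : ‖V y‖ ^ s ≤ d⁻¹ := by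
      rw [← one_div, le_div_iff₀ hd0, mul_comm]
      exact (mul_le_mul_of_nonneg_right (hnorm y hy) (by positivity)).trans (hR' y hy).2.2.1
    rw [h2]
    gcongr
    exact hbd y hy
  have h := norm_fderiv_le_of_laplacian_bound hd0
    (fun y hy => contDiffAt_const.inner ℝ (hR' y hy).1)
    (fun y hy => ((abs_real_inner_le_norm e (V y)).trans_eq (by rw [he, one_mul])).trans (hbd y hy))
    hlap
  refine h.trans_eq ?_
  have h4 : d ^ (2 - n) = d * d ^ (1 - n) := by
    rw [show 2 - n = 1 + (1 - n) by ring, Real.rpow_add hd0, Real.rpow_one]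
  have h5 : d ^ (1 - n) = (1 / 2) ^ (1 - n) * ‖x‖ ^ (1 - n) := by
    rw [← Real.mul_rpow (by norm_num) (norm_nonneg x), hd]
    congr 1
    ring
  rw [h4, mul_assoc _ ((1 / 2 : ℝ) ^ (1 - n)), ← h5, ← hn]
  field_simp

end Comparison

/-! ### Reduction of the system to a differential inequality, and conclusion -/

section System

variable {n m : ℕ} {A : Matrix (Fin m) (Fin m) ℝ} {f : Fin m → EuclideanSpace ℝ (Fin m) → ℝ}
  {V : EuclideanSpace ℝ (Fin n) → EuclideanSpace ℝ (Fin m)} {U : Set (EuclideanSpace ℝ (Fin n))}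

theorem IsSolutionOn.contDiffAt (hV : IsSolutionOn A f V U) (hU : IsOpen U)
    {x : EuclideanSpace ℝ (Fin n)} (hx : x ∈ U) : ContDiffAt ℝ 2 V x :=
  hV.1.contDiffAt (hU.mem_nhds hx)

theorem abs_laplacian_inner_le_sum {x : EuclideanSpace ℝ (Fin n)} (hV : ContDiffAt ℝ 2 V x)
    {e : EuclideanSpace ℝ (Fin m)} (he : ‖e‖ = 1) :
    |Laplacian.laplacian (fun z => inner ℝ e (V z)) x| ≤
      ∑ j, |Laplacian.laplacian (fun z => V z j) x| := by
  have h1 : Laplacian.laplacian (fun z => inner ℝ e (V z)) x =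
      inner ℝ e (Laplacian.laplacian V x) := hV.laplacian_CLM_comp_left (l := innerSL ℝ e)
  have h2 : ∀ j, Laplacian.laplacian (fun z => V z j) x = (Laplacian.laplacian V x) j :=
    fun j => hV.laplacian_CLM_comp_left (l := EuclideanSpace.proj j)
  rw [h1]
  simp only [h2]
  set w := Laplacian.laplacian V x
  rw [PiLp.inner_apply]
  refine (Finset.abs_sum_le_sum_abs _ _).trans (Finset.sum_le_sum fun j _ => ?_)
  refine (abs_real_inner_le_norm _ _).trans ?_
  have h3 : ‖e j‖ ≤ 1 := he ▸ PiLp.norm_apply_le e j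
  rw [← Real.norm_eq_abs (w j)]
  exact mul_le_of_le_one_left (norm_nonneg _) h3

/-- Solve for each `Δ V_j` with `A⁻¹`. All unit directions `e` are needed, because the comparison
and concentration arguments use the direction of `V` at a point not known beforehand. -/
theorem IsSolutionOn.abs_laplacian_inner_le (hV : IsSolutionOn A f V U) (hU : IsOpen U)
    (hA : A.PosDef) {C q : ℝ} (hf : ∀ i v, |f i v| ≤ C * ‖v‖ ^ q)
    {x : EuclideanSpace ℝ (Fin n)} (hx : x ∈ U) {e : EuclideanSpace ℝ (Fin m)} (he : ‖e‖ = 1) :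
    |Laplacian.laplacian (fun z => inner ℝ e (V z)) x| ≤
      (∑ j, ∑ i, |A⁻¹ j i|) * |C| * ‖V x‖ ^ q := by
  refine (abs_laplacian_inner_le_sum (hV.contDiffAt hU hx) he).trans ?_
  have hdet : IsUnit A.det := hA.det_pos.ne'.isUnit
  have h1 : A.mulVec (fun j => Laplacian.laplacian (fun z => V z j) x) = fun i => f i (V x) :=
    funext fun i => hV.2 x hx i
  have h2 : ∀ j, Laplacian.laplacian (fun z => V z j) x = ∑ i, A⁻¹ j i * f i (V x) := by
    intro j
    have h3 := congrArg (A⁻¹.mulVec) h1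
    rw [Matrix.mulVec_mulVec, Matrix.nonsing_inv_mul A hdet, Matrix.one_mulVec] at h3
    exact congrFun h3 j
  simp only [h2]
  rw [mul_assoc, Finset.sum_mul]
  refine Finset.sum_le_sum fun j _ => (Finset.abs_sum_le_sum_abs _ _).trans ?_
  rw [Finset.sum_mul]
  refine Finset.sum_le_sum fun i _ => ?_
  rw [abs_mul]
  gcongr
  exact (hf i _).trans (by gcongr; exact le_abs_self C)

theorem gradNorm_le {x : EuclideanSpace ℝ (Fin n)} {B : ℝ} (hB : 0 ≤ B)
    (h : ∀ e : EuclideanSpace ℝ (Fin m), ‖e‖ = 1 → ‖fderiv ℝ (fun z => inner ℝ e (V z)) x‖ ≤ B) :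
    gradNorm V x ≤ Real.sqrt m * B := by
  have h1 : ∀ j, ‖gradient (fun y => V y j) x‖ ≤ B := by
    intro j
    have h2 := h (EuclideanSpace.single j 1) (by simp)
    simp only [EuclideanSpace.inner_single_left, map_one, one_mul] at h2
    rwa [gradient, LinearIsometryEquiv.norm_map]
  calc gradNorm V x ≤ Real.sqrt (∑ _j : Fin m, B ^ 2) := by
        refine Real.sqrt_le_sqrt (Finset.sum_le_sum fun j _ => ?_)
        gcongr
        exact h1 j
    _ = Real.sqrt m * B := by
        rw [Finset.sum_const, Finset.card_univ, Fintype.card_fin, nsmul_eq_mul,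
          Real.sqrt_mul (by positivity), Real.sqrt_sq hB]

end System

/-- Finite scale invariant energy near infinity forces scale invariant decay. -/
theorem eventually_norm_mul_rpow_le {E F : Type*} [NormedAddCommGroup E] [InnerProductSpace ℝ E]
    [FiniteDimensional ℝ E] [Nontrivial E] [MeasurableSpace E] [BorelSpace E]
    [NormedAddCommGroup F] [InnerProductSpace ℝ F] {V : E → F} {K : Set E} {s C p : ℝ}
    (hs : 0 < s) (hC : 0 ≤ C) (hp : p = Module.finrank ℝ E * s) (hK : IsCompact K)
    (hV : ∀ y ∉ K, ContDiffAt ℝ 2 V y)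
    (hΔ : ∀ y ∉ K, ∀ e : F, ‖e‖ = 1 →
      |Laplacian.laplacian (fun z => inner ℝ e (V z)) y| ≤ C * ‖V y‖ ^ (1 + 2 * s))
    (hVp : MemLp V (ENNReal.ofReal p) (volume.restrict Kᶜ)) {δ : ℝ} (hδ : 0 < δ) :
    ∀ᶠ y in Bornology.cobounded E, ‖y‖ * ‖V y‖ ^ s ≤ δ := by
  have hn : 0 < Module.finrank ℝ E := Module.finrank_pos
  have hp0 : 0 < p := by rw [hp]; positivity
  obtain ⟨ε, hε, hthr⟩ := exists_energy_threshold (E := E) (F := F) hs hC (half_pos hδ) hp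
  have hfin : ∫⁻ y, ‖V y‖ₑ ^ p ∂(volume.restrict Kᶜ) ≠ ⊤ := by
    have := lintegral_rpow_enorm_lt_top_of_eLpNorm_lt_top
      (ENNReal.ofReal_pos.2 hp0).ne' ENNReal.ofReal_ne_top hVp.eLpNorm_lt_top
    rw [ENNReal.toReal_ofReal hp0.le] at this
    exact this.ne
  obtain ⟨R, hR⟩ := exists_setLIntegral_norm_ge_lt hfin hε
  obtain ⟨R', hR'⟩ := hK.isBounded.subset_closedBall 0
  filter_upwards [eventually_le_norm (2 * R), eventually_le_norm (2 * R' + 1),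
    eventually_le_norm 1] with x h1 h2 h3
  -- The ball of radius `‖x‖ / 2` about `x` avoids `K` and stays where the energy is below the
  -- threshold; the halved radius is why the threshold is taken for `δ / 2`.
  set D := ‖x‖ / 2 with hD
  have hD0 : 0 < D := by positivity
  have hnorm : ∀ y ∈ Metric.closedBall x D, D ≤ ‖y‖ := by
    intro y hy
    have h1 : ‖x - y‖ ≤ D := by
      rw [← dist_eq_norm, dist_comm]
      exact hy
    have h2 := norm_sub_norm_le x y
    have h3 : ‖x‖ = 2 * D := by rw [hD]; ring
    linarith
  have hout : ∀ y ∈ Metric.closedBall x D, y ∉ K := by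
    intro y hy hyK
    have h4 : ‖y‖ ≤ R' := by simpa using hR' hyK
    linarith [hnorm y hy]
  have h5 := hthr V x D hD0 (fun y hy => hV y (hout y hy)) (fun y hy => hΔ y (hout y hy)) ?_
  · have h6 : ‖x‖ * ‖V x‖ ^ s = 2 * (D * ‖V x‖ ^ s) := by rw [hD]; ring
    linarith
  · refine lt_of_le_of_lt ?_ hR
    refine lintegral_mono' ?_ le_rfl
    rw [Measure.restrict_restrict (measurableSet_le measurable_const measurable_norm)]
    have hsub : Metric.closedBall x D ⊆ {y | R ≤ ‖y‖} ∩ Kᶜ := fun y hy =>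
      ⟨(by linarith : R ≤ D).trans (hnorm y hy), hout y hy⟩
    exact Measure.restrict_mono hsub le_rfl

theorem theorem1 (n m : ℕ) (hn : 3 ≤ n)
    (A : Matrix (Fin m) (Fin m) ℝ) (hA : A.PosDef)
    (q p : ℝ) (hq : ((n : ℝ) + 2) / n < q) (hp : p = (n : ℝ) / 2 * (q - 1))
    (f : Fin m → EuclideanSpace ℝ (Fin m) → ℝ) (hf : ∀ i, Differentiable ℝ (f i))
    (C : ℝ)
    (hA1 : ∀ i v, |f i v| ≤ C * ‖v‖ ^ q)
    (hA2 : ∀ i v, ‖gradient (f i) v‖ ≤ C * ‖v‖ ^ (q - 1))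
    (K : Set (EuclideanSpace ℝ (Fin n))) (hK : IsCompact K)
    (V : EuclideanSpace ℝ (Fin n) → EuclideanSpace ℝ (Fin m))
    (hV : IsSolutionOn A f V Kᶜ)
    (hVp : MemLp V (ENNReal.ofReal p) (volume.restrict Kᶜ)) :
    (fun x => ‖V x‖) =O[Bornology.cobounded (EuclideanSpace ℝ (Fin n))]
        (fun x => ‖x‖ ^ (-((n : ℝ) - 2))) ∧
      (fun x => gradNorm V x) =O[Bornology.cobounded (EuclideanSpace ℝ (Fin n))]
        (fun x => ‖x‖ ^ (-((n : ℝ) - 1))) := by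
  have hn0 : (0 : ℝ) < n := by positivity
  have hn2 : (2 : ℝ) < n := by exact_mod_cast hn
  obtain ⟨s, hs⟩ : ∃ s, s = (q - 1) / 2 := ⟨_, rfl⟩
  have hs0 : 0 < s := by
    have h1 : (1 : ℝ) < ((n : ℝ) + 2) / n := by
      rw [lt_div_iff₀ hn0]
      linarith
    linarith
  obtain rfl : q = 1 + 2 * s := by linarith
  have hfin : Module.finrank ℝ (EuclideanSpace ℝ (Fin n)) = n := by simp
  have : Nontrivial (EuclideanSpace ℝ (Fin n)) :=
    Module.finrank_pos_iff (R := ℝ).1 (by rw [hfin]; omega)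
  have hU : IsOpen Kᶜ := hK.isClosed.isOpen_compl
  have hfar : ∀ᶠ y in Bornology.cobounded (EuclideanSpace ℝ (Fin n)), y ∈ Kᶜ :=
    Bornology.isBounded_def.1 hK.isBounded
  set C₁ := (∑ j, ∑ i, |A⁻¹ j i|) * |C| with hC₁
  have hC₁0 : 0 ≤ C₁ := by positivity
  have hc : ∀ y ∉ K, ContDiffAt ℝ 2 V y := fun y hy => hV.contDiffAt hU hy
  have hΔ : ∀ y ∉ K, ∀ e : EuclideanSpace ℝ (Fin m), ‖e‖ = 1 →
      |Laplacian.laplacian (fun z => inner ℝ e (V z)) y| ≤ C₁ * ‖V y‖ ^ (1 + 2 * s) :=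
    fun y hy e he => hV.abs_laplacian_inner_le hU hA hA1 hy he
  have hc' := hfar.mono hc
  have hΔ' := hfar.mono hΔ
  have hdecay : ∀ δ > 0, ∀ᶠ y in Bornology.cobounded (EuclideanSpace ℝ (Fin n)),
      ‖y‖ * ‖V y‖ ^ s ≤ δ := fun δ hδ =>
    eventually_norm_mul_rpow_le hs0 hC₁0 (by rw [hp, hfin]; ring) hK hc hΔ hVp hδ
  obtain ⟨M, hM0, hM⟩ := exists_fundamental_decay hs0 hC₁0 hc' hΔ' hdecay (by rwa [hfin])
  obtain ⟨L, hL⟩ := exists_gradient_decay hC₁0 hM0 hc' hΔ' hs0 (hdecay 1 one_pos) (by rwa [hfin]) hM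
  rw [hfin] at hM hL
  constructor
  · refine IsBigO.of_bound M (hM.mono fun x hx => ?_)
    rw [norm_norm, Real.norm_of_nonneg (by positivity), neg_sub]
    exact hx
  -- The sign of `L` is not known, hence `|L|`.
  · refine IsBigO.of_bound (Real.sqrt m * |L|) (hL.mono fun x hx => ?_)
    rw [Real.norm_of_nonneg (show 0 ≤ gradNorm V x from Real.sqrt_nonneg _), Real.norm_of_nonneg (by positivity), neg_sub,
      mul_assoc]
    refine gradNorm_le (by positivity) fun e he => (hx e he).trans ?_
    gcongr
    exact le_abs_self L
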